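/- **Theorem (well-posedness of the three-field mixed Reissner–Mindlin problem for $t>0$).** Let $A\subset\mathbb R^2$ be a bounded, contractible, open set. Let $E>0$, $-1<\nu<1$, $k_s>0$, $\mu>0$, $t>0$, and let $$\mathbb A\,\mathbf S=\tfrac{12}{E}\big[(1+\nu)\,\mathbf S-\nu\,(\operatorname{tr}\mathbf S)\,\mathbf 1\big],\qquad \mathbf S\in\mathbb R^{2\times2}.$$ Let $H^1_0(A)$ be the closure of $C_c^\infty(A)$ in $H^1(A)$, and let $$H(\mathrm{sym},\mathrm{Div},A)=\{\mathbf M\in[L^2(A)]^{2\times2} : \mathbf M=\mathbf M^T,\ \operatorname{Div}\mathbf M\in[L^2(A)]^2\},\qquad \|\mathbf M\|_{H(\mathrm{sym},\mathrm{Div})}^2=\|\mathbf M\|_{L^2}^2+\|\operatorname{Div}\mathbf M\|_{L^2}^2,$$ with $\operatorname{Div}$ the row-wise weak divergence. Set $Y(A)=H^1_0(A)\times[L^2(A)]^2$ and $X(A)=Y(A)\times H(\mathrm{sym},\mathrm{Div},A)$ with $$\|\{w,\boldsymbol\phi\}\|_Y^2=\|w\|_{H^1}^2+\|\boldsymbol\phi\|_{L^2}^2,\qquad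 \|\{w,\boldsymbol\phi,\mathbf M\}\|_X^2=\|\{w,\boldsymbol\phi\}\|_Y^2+\|\mathbf M\|_{H(\mathrm{sym},\mathrm{Div})}^2 .$$ Let $g\in (H^1_0(A))'$ be a load. The expression $\int_A\delta w\,g\,\mathrm dA$ denotes the duality pairing $g(\delta w)$ (the ordinary integral if $g\in L^2(A)$), and $\|g\|_{Y'}$ is the norm of $\{\delta w,\delta\boldsymbol\phi\}\mapsto\int_A\delta w\,g\,\mathrm dA$ in the dual space $Y'$ of $Y(A)$. Let $\widetilde{\boldsymbol\phi}\in[H^1(A)]^2$ be boundary rotation data, with Neumann term understood through Green's formula, $$\int_{\partial A}\langle\delta\mathbf M\,\mathbf n,\widetilde{\boldsymbol\phi}\rangle\,\mathrm ds:=\int_A\langle\operatorname{Div}\delta\mathbf M,\widetilde{\boldsymbol\phi}\rangle+\langle\delta\mathbf M,\mathrm D\widetilde{\boldsymbol\phi}\rangle\,\mathrm dA ,$$ where $(\mathrm D\widetilde{\boldsymbol\phi})_{ij}=\partial_j\widetilde\phi_i$ and $\|\widetilde{\boldsymbol\phi}\|_{H^1}^2=\|\widetilde{\boldsymbol\phi}\|_{L^2}^2+\|\mathrm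 D\widetilde{\boldsymbol\phi}\|_{L^2}^2$. Consider the problem: find $\{w,\boldsymbol\phi,\mathbf M\}\in X(A)$ such that $$\int_A\langle\delta\mathbf M,\mathbb A\mathbf M\rangle+\langle\operatorname{Div}\delta\mathbf M,\boldsymbol\phi\rangle\,\mathrm dA=\int_{\partial A}\langle\delta\mathbf M\,\mathbf n,\widetilde{\boldsymbol\phi}\rangle\,\mathrm ds\qquad\forall\,\delta\mathbf M\in H(\mathrm{sym},\mathrm{Div},A),$$ $$\int_A\langle\delta\boldsymbol\phi,\operatorname{Div}\mathbf M\rangle-\frac{k_s\mu}{t^2}\langle\nabla\delta w-\delta\boldsymbol\phi,\nabla w-\boldsymbol\phi\rangle\,\mathrm dA=-\int_A\delta w\,g\,\mathrm dA\qquad\forall\,\{\delta w,\delta\boldsymbol\phi\}\in Y(A).$$ This problem is well-posed: for all data $g$ and $\widetilde{\boldsymbol\phi}$ it has exactly one solution $\{w,\boldsymbol\phi,\mathbf M\}\in X(A)$, and the solution satisfies $$\|\{w,\boldsymbol\phi\}\|_Y+\|\{\mathbf M,\nabla w-\boldsymbol\phi\}\|_{H(\mathrm{sym},\mathrm{Div})\times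 L^2}\le c\,\big(\|g\|_{Y'}+\|\widetilde{\boldsymbol\phi}\|_{H^1}\big),$$ where $\|\{\mathbf M,\mathbf q\}\|_{H(\mathrm{sym},\mathrm{Div})\times L^2}^2=\|\mathbf M\|_{H(\mathrm{sym},\mathrm{Div})}^2+\|\mathbf q\|_{L^2}^2$ and $c>0$ depends only on $A$, $\mathbb A$ (that is, on $E$ and $\nu$), the product $k_s\mu$, and $t$. In particular, for homogeneous data $\widetilde{\boldsymbol\phi}=0$, $$\|\{w,\boldsymbol\phi\}\|_Y+\|\{\mathbf M,\nabla w-\boldsymbol\phi\}\|_{H(\mathrm{sym},\mathrm{Div})\times L^2}\le c\,\|g\|_{Y'} .$$ -/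

import Mathlib

open MeasureTheory
open scoped ContDiff Gradient

noncomputable section

namespace ReissnerMindlin

/-- The Euclidean plane `ℝ²`. -/
abbrev Plane : Type := EuclideanSpace ℝ (Fin 2)

/-- Real `2 × 2` matrices, stored by rows, with the Frobenius inner product
`⟨S, T⟩ = S i j * T i j`. -/
abbrev Mat2 : Type := PiLp 2 (fun _ : Fin 2 => Plane)

/-- `L²(A)`. -/
abbrev L2 (A : Set Plane) : Type := Lp ℝ 2 (volume.restrict A)

/-- `[L²(A)]²`. -/
abbrev L2Vec (A : Set Plane) : Type := Lp Plane 2 (volume.restrict A)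

/-- `[L²(A)]^(2×2)`. -/
abbrev L2Mat (A : Set Plane) : Type := Lp Mat2 2 (volume.restrict A)

/-- `ψ` is a test function, an element of `C_c^∞(A)`. -/
def IsTest (A : Set Plane) (ψ : Plane → ℝ) : Prop :=
  ContDiff ℝ ∞ ψ ∧ HasCompactSupport ψ ∧ tsupport ψ ⊆ A

/-- `G` is the weak gradient of `u` on `A`. -/
def HasWeakGrad (A : Set Plane) (u : Plane → ℝ) (G : Plane → Plane) : Prop :=
  ∀ ψ : Plane → ℝ, IsTest A ψ → ∫ x in A, u x • ∇ ψ x = -∫ x in A, ψ x • G x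

/-- `d` is the weak divergence of the vector field `v` on `A`. -/
def HasWeakDiv (A : Set Plane) (v : Plane → Plane) (d : Plane → ℝ) : Prop :=
  ∀ ψ : Plane → ℝ, IsTest A ψ → ∫ x in A, inner ℝ (v x) (∇ ψ x) = -∫ x in A, ψ x * d x

section helpers

variable {A : Set Plane} {ψ : Plane → ℝ}

lemma isTest_zero : IsTest A (fun _ => 0) :=
  ⟨contDiff_const, HasCompactSupport.zero, by
    have h : tsupport (fun _ : Plane => (0 : ℝ)) = ∅ := tsupport_eq_empty_iff.2 rfl
    simp [h]⟩

lemma IsTest.add {χ : Plane → ℝ} (h : IsTest A ψ) (h' : IsTest A χ) :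
    IsTest A (fun x => ψ x + χ x) :=
  ⟨h.1.add h'.1, h.2.1.add h'.2.1,
    (tsupport_add ψ χ).trans (Set.union_subset h.2.2 h'.2.2)⟩

lemma IsTest.const_mul (h : IsTest A ψ) (a : ℝ) : IsTest A (fun x => a * ψ x) :=
  ⟨contDiff_const.mul h.1, h.2.1.mul_left,
    (closure_mono (Function.support_mul_subset_right (fun _ => a) ψ)).trans h.2.2⟩

lemma IsTest.differentiable (h : IsTest A ψ) : Differentiable ℝ ψ :=
  h.1.differentiable (by simp)

lemma IsTest.memLp (h : IsTest A ψ) : MemLp ψ 2 (volume.restrict A) :=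
  (h.1.continuous.memLp_of_hasCompactSupport h.2.1).restrict A

lemma IsTest.memLp_grad (h : IsTest A ψ) : MemLp (∇ ψ) 2 (volume.restrict A) := by
  have hc : Continuous (∇ ψ) :=
    (InnerProductSpace.toDual ℝ Plane).symm.continuous.comp (h.1.continuous_fderiv (by simp))
  have hs : HasCompactSupport (∇ ψ) :=
    (h.2.1.fderiv (𝕜 := ℝ)).comp_left (g := (InnerProductSpace.toDual ℝ Plane).symm) (by simp)
  exact (hc.memLp_of_hasCompactSupport hs).restrict A

lemma integrable_smul_of_memLp {F : Type*} [NormedAddCommGroup F] [NormedSpace ℝ F]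
    {f : Plane → ℝ} {g : Plane → F} (hf : MemLp f 2 (volume.restrict A))
    (hg : MemLp g 2 (volume.restrict A)) : IntegrableOn (fun x => f x • g x) A :=
  memLp_one_iff_integrable.1 (hg.smul hf)

lemma integrable_inner_of_memLp {F : Type*} [NormedAddCommGroup F] [InnerProductSpace ℝ F]
    {f g : Plane → F} (hf : MemLp f 2 (volume.restrict A))
    (hg : MemLp g 2 (volume.restrict A)) : IntegrableOn (fun x => inner ℝ (f x) (g x)) A := by
  refine (L2.integrable_inner (𝕜 := ℝ) (hf.toLp f) (hg.toLp g)).congr ?_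
  filter_upwards [hf.coeFn_toLp, hg.coeFn_toLp] with x h₁ h₂
  rw [h₁, h₂]

lemma memLp_row {F : Plane → Mat2} (hF : MemLp F 2 (volume.restrict A)) (i : Fin 2) :
    MemLp (fun x => F x i) 2 (volume.restrict A) :=
  (PiLp.proj (𝕜 := ℝ) 2 (fun _ : Fin 2 => Plane) i).comp_memLp' hF

lemma memLp_coord {F : Plane → Plane} (hF : MemLp F 2 (volume.restrict A)) (i : Fin 2) :
    MemLp (fun x => F x i) 2 (volume.restrict A) :=
  (EuclideanSpace.proj (𝕜 := ℝ) (ι := Fin 2) i).comp_memLp' hF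

lemma HasWeakGrad.congr {u u' : Plane → ℝ} {G G' : Plane → Plane} (h : HasWeakGrad A u G)
    (hu : u =ᵐ[volume.restrict A] u') (hG : G =ᵐ[volume.restrict A] G') :
    HasWeakGrad A u' G' := by
  intro ψ hψ
  have h₁ : ∫ x in A, u' x • ∇ ψ x = ∫ x in A, u x • ∇ ψ x :=
    integral_congr_ae (by filter_upwards [hu] with x hx; rw [hx])
  have h₂ : ∫ x in A, ψ x • G' x = ∫ x in A, ψ x • G x :=
    integral_congr_ae (by filter_upwards [hG] with x hx; rw [hx])
  rw [h₁, h₂, h ψ hψ]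

lemma HasWeakDiv.congr {v v' : Plane → Plane} {d d' : Plane → ℝ} (h : HasWeakDiv A v d)
    (hv : v =ᵐ[volume.restrict A] v') (hd : d =ᵐ[volume.restrict A] d') :
    HasWeakDiv A v' d' := by
  intro ψ hψ
  have h₁ : ∫ x in A, inner ℝ (v' x) (∇ ψ x) = ∫ x in A, inner ℝ (v x) (∇ ψ x) :=
    integral_congr_ae (by filter_upwards [hv] with x hx; rw [hx])
  have h₂ : ∫ x in A, ψ x * d' x = ∫ x in A, ψ x * d x :=
    integral_congr_ae (by filter_upwards [hd] with x hx; rw [hx])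
  rw [h₁, h₂, h ψ hψ]

lemma HasWeakGrad.zero : HasWeakGrad A (fun _ => 0) (fun _ => 0) := by
  intro ψ _; simp

lemma HasWeakDiv.zero : HasWeakDiv A (fun _ => 0) (fun _ => 0) := by
  intro ψ _; simp

lemma HasWeakGrad.add {u u' : Plane → ℝ} {G G' : Plane → Plane}
    (hu : MemLp u 2 (volume.restrict A)) (hu' : MemLp u' 2 (volume.restrict A))
    (hG : MemLp G 2 (volume.restrict A)) (hG' : MemLp G' 2 (volume.restrict A))
    (h : HasWeakGrad A u G) (h' : HasWeakGrad A u' G') :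
    HasWeakGrad A (fun x => u x + u' x) (fun x => G x + G' x) := by
  intro ψ hψ
  simp only [add_smul, smul_add]
  rw [integral_add (integrable_smul_of_memLp hu hψ.memLp_grad)
    (integrable_smul_of_memLp hu' hψ.memLp_grad),
    integral_add (integrable_smul_of_memLp hψ.memLp hG)
    (integrable_smul_of_memLp hψ.memLp hG'), h ψ hψ, h' ψ hψ]
  abel

lemma HasWeakDiv.add {v v' : Plane → Plane} {d d' : Plane → ℝ}
    (hv : MemLp v 2 (volume.restrict A)) (hv' : MemLp v' 2 (volume.restrict A))
    (hd : MemLp d 2 (volume.restrict A)) (hd' : MemLp d' 2 (volume.restrict A))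
    (h : HasWeakDiv A v d) (h' : HasWeakDiv A v' d') :
    HasWeakDiv A (fun x => v x + v' x) (fun x => d x + d' x) := by
  intro ψ hψ
  simp only [inner_add_left, mul_add]
  rw [integral_add (integrable_inner_of_memLp hv hψ.memLp_grad)
    (integrable_inner_of_memLp hv' hψ.memLp_grad),
    integral_add (f := fun x => ψ x * d x) (g := fun x => ψ x * d' x)
    (integrable_smul_of_memLp hψ.memLp hd)
    (integrable_smul_of_memLp hψ.memLp hd'), h ψ hψ, h' ψ hψ]
  abel

lemma HasWeakGrad.smul {u : Plane → ℝ} {G : Plane → Plane} (a : ℝ) (h : HasWeakGrad A u G) :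
    HasWeakGrad A (fun x => a * u x) (fun x => a • G x) := by
  intro ψ hψ
  simp only [mul_smul, smul_comm _ a, integral_smul]
  rw [h ψ hψ, smul_neg]

lemma HasWeakDiv.smul {v : Plane → Plane} {d : Plane → ℝ} (a : ℝ) (h : HasWeakDiv A v d) :
    HasWeakDiv A (fun x => a • v x) (fun x => a * d x) := by
  intro ψ hψ
  simp only [real_inner_smul_left, mul_left_comm _ a, integral_const_mul]
  rw [h ψ hψ, mul_neg]

end helpers

/-- The pairs `(ψ, ∇ψ)` with `ψ ∈ C_c^∞(A)`, inside `L²(A) × [L²(A)]²`. -/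
def testGraph (A : Set Plane) : Submodule ℝ (WithLp 2 (L2 A × L2Vec A)) where
  carrier := {p | ∃ ψ : Plane → ℝ, IsTest A ψ ∧
    p.fst =ᵐ[volume.restrict A] ψ ∧ p.snd =ᵐ[volume.restrict A] ∇ ψ}
  zero_mem' := ⟨fun _ => 0, isTest_zero, Lp.coeFn_zero _ _ _, by
    rw [gradient_fun_const']; exact Lp.coeFn_zero _ _ _⟩
  add_mem' := by
    rintro p q ⟨ψ, hψ, h₁, h₂⟩ ⟨χ, hχ, k₁, k₂⟩
    refine ⟨_, hψ.add hχ, ?_, ?_⟩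
    · filter_upwards [Lp.coeFn_add p.fst q.fst, h₁, k₁] with x hx e₁ e₂
      simpa [e₁, e₂] using hx
    · filter_upwards [Lp.coeFn_add p.snd q.snd, h₂, k₂] with x hx e₁ e₂
      have : ∇ (fun x => ψ x + χ x) x = ∇ ψ x + ∇ χ x := by
        simp only [gradient]
        rw [fderiv_fun_add (hψ.differentiable x) (hχ.differentiable x), map_add]
      rw [this, ← e₁, ← e₂]
      simpa using hx
  smul_mem' := by
    rintro a p ⟨ψ, hψ, h₁, h₂⟩
    refine ⟨_, hψ.const_mul a, ?_, ?_⟩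
    · filter_upwards [Lp.coeFn_smul a p.fst, h₁] with x hx e₁
      simpa [e₁] using hx
    · filter_upwards [Lp.coeFn_smul a p.snd, h₂] with x hx e₁
      have : ∇ (fun x => a * ψ x) x = a • ∇ ψ x := by
        simp only [gradient]
        rw [fderiv_const_mul (hψ.differentiable x)]
        exact map_smul (InnerProductSpace.toDual ℝ Plane).symm a _
      rw [this, ← e₁]
      simpa using hx

/-- `H¹₀(A)`, the closure of `C_c^∞(A)` in the `H¹`-norm. A function `w` is stored together with
its weak gradient, as the pair `(w, ∇w)`, so that the norm is `‖w‖² + ‖∇w‖²` under the root. -/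
abbrev H01 (A : Set Plane) : Type := (testGraph A).topologicalClosure

/-- The deflection `w` of an element of `H¹₀(A)`. -/
def H01.val {A : Set Plane} (w : H01 A) : L2 A := (w : WithLp 2 (L2 A × L2Vec A)).fst

/-- The weak gradient `∇w` of an element of `H¹₀(A)`. -/
def H01.grad {A : Set Plane} (w : H01 A) : L2Vec A := (w : WithLp 2 (L2 A × L2Vec A)).snd

/-- The pairs `(v, D v)` with `v ∈ [H¹(A)]²` and `(D v) i j = ∂ⱼ vᵢ`. -/
def h1VecGraph (A : Set Plane) : Submodule ℝ (WithLp 2 (L2Vec A × L2Mat A)) where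
  carrier := {p | ∀ i : Fin 2, HasWeakGrad A (fun x => p.fst x i) (fun x => p.snd x i)}
  zero_mem' := fun i => HasWeakGrad.zero.congr
    (by filter_upwards [Lp.coeFn_zero Plane 2 (volume.restrict A)] with x hx
        change _ = (0 : L2Vec A) x i
        rw [hx]; rfl)
    (by filter_upwards [Lp.coeFn_zero Mat2 2 (volume.restrict A)] with x hx
        change _ = (0 : L2Mat A) x i
        rw [hx]; rfl)
  add_mem' := fun {p q} hp hq i =>
    (HasWeakGrad.add (memLp_coord (Lp.memLp p.fst) i) (memLp_coord (Lp.memLp q.fst) i)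
      (memLp_row (Lp.memLp p.snd) i) (memLp_row (Lp.memLp q.snd) i) (hp i) (hq i)).congr
    (by filter_upwards [Lp.coeFn_add p.fst q.fst] with x hx
        change _ = (p.fst + q.fst : L2Vec A) x i
        rw [hx]; rfl)
    (by filter_upwards [Lp.coeFn_add p.snd q.snd] with x hx
        change _ = (p.snd + q.snd : L2Mat A) x i
        rw [hx]; rfl)
  smul_mem' := fun a p hp i => (HasWeakGrad.smul a (hp i)).congr
    (by filter_upwards [Lp.coeFn_smul a p.fst] with x hx
        change _ = (a • p.fst : L2Vec A) x i
        rw [hx]; rfl)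
    (by filter_upwards [Lp.coeFn_smul a p.snd] with x hx
        change _ = (a • p.snd : L2Mat A) x i
        rw [hx]; rfl)

/-- `[H¹(A)]²` with the norm `(‖v‖² + ‖D v‖²)^(1/2)`; a field `v` is stored together with its weak
derivative, as the pair `(v, D v)`. -/
abbrev H1Vec (A : Set Plane) : Type := h1VecGraph A

/-- The vector field `v` of an element of `[H¹(A)]²`. -/
def H1Vec.val {A : Set Plane} (v : H1Vec A) : L2Vec A := (v : WithLp 2 (L2Vec A × L2Mat A)).fst

/-- The weak derivative `D v` of an element of `[H¹(A)]²`. -/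
def H1Vec.deriv {A : Set Plane} (v : H1Vec A) : L2Mat A := (v : WithLp 2 (L2Vec A × L2Mat A)).snd

/-- The pairs `(M, Div M)`, where `M` is an almost everywhere symmetric square integrable matrix
field whose row-wise weak divergence `Div M` is square integrable. -/
def hSymDivGraph (A : Set Plane) : Submodule ℝ (WithLp 2 (L2Mat A × L2Vec A)) where
  carrier := {p | (∀ᵐ x ∂(volume.restrict A), ∀ i j : Fin 2, p.fst x i j = p.fst x j i) ∧
    ∀ i : Fin 2, HasWeakDiv A (fun x => p.fst x i) (fun x => p.snd x i)}
  zero_mem' := by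
    refine ⟨?_, fun i => HasWeakDiv.zero.congr ?_ ?_⟩
    · filter_upwards [Lp.coeFn_zero Mat2 2 (volume.restrict A)] with x hx i j
      change (0 : L2Mat A) x i j = (0 : L2Mat A) x j i
      rw [hx]; rfl
    · filter_upwards [Lp.coeFn_zero Mat2 2 (volume.restrict A)] with x hx
      change _ = (0 : L2Mat A) x i
      rw [hx]; rfl
    · filter_upwards [Lp.coeFn_zero Plane 2 (volume.restrict A)] with x hx
      change _ = (0 : L2Vec A) x i
      rw [hx]; rfl
  add_mem' := by
    rintro p q ⟨sp, hp⟩ ⟨sq, hq⟩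
    refine ⟨?_, fun i => (HasWeakDiv.add (memLp_row (Lp.memLp p.fst) i)
      (memLp_row (Lp.memLp q.fst) i) (memLp_coord (Lp.memLp p.snd) i)
      (memLp_coord (Lp.memLp q.snd) i) (hp i) (hq i)).congr ?_ ?_⟩
    · filter_upwards [Lp.coeFn_add p.fst q.fst, sp, sq] with x hx e₁ e₂ i j
      change (p.fst + q.fst : L2Mat A) x i j = (p.fst + q.fst : L2Mat A) x j i
      rw [hx]
      change p.fst x i j + q.fst x i j = p.fst x j i + q.fst x j i
      rw [e₁ i j, e₂ i j]
    · filter_upwards [Lp.coeFn_add p.fst q.fst] with x hx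
      change _ = (p.fst + q.fst : L2Mat A) x i
      rw [hx]; rfl
    · filter_upwards [Lp.coeFn_add p.snd q.snd] with x hx
      change _ = (p.snd + q.snd : L2Vec A) x i
      rw [hx]; rfl
  smul_mem' := by
    rintro a p ⟨sp, hp⟩
    refine ⟨?_, fun i => (HasWeakDiv.smul a (hp i)).congr ?_ ?_⟩
    · filter_upwards [Lp.coeFn_smul a p.fst, sp] with x hx e₁ i j
      change (a • p.fst : L2Mat A) x i j = (a • p.fst : L2Mat A) x j i
      rw [hx]
      change a * p.fst x i j = a * p.fst x j i
      rw [e₁ i j]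
    · filter_upwards [Lp.coeFn_smul a p.fst] with x hx
      change _ = (a • p.fst : L2Mat A) x i
      rw [hx]; rfl
    · filter_upwards [Lp.coeFn_smul a p.snd] with x hx
      change _ = (a • p.snd : L2Vec A) x i
      rw [hx]; rfl

/-- `H(sym, Div, A)` with the norm `(‖M‖² + ‖Div M‖²)^(1/2)`; a field `M` is stored together with
its weak divergence, as the pair `(M, Div M)`. -/
abbrev HSymDiv (A : Set Plane) : Type := hSymDivGraph A

/-- The matrix field `M` of an element of `H(sym, Div, A)`. -/
def HSymDiv.val {A : Set Plane} (M : HSymDiv A) : L2Mat A :=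
  (M : WithLp 2 (L2Mat A × L2Vec A)).fst

/-- The weak divergence `Div M` of an element of `H(sym, Div, A)`. -/
def HSymDiv.div {A : Set Plane} (M : HSymDiv A) : L2Vec A :=
  (M : WithLp 2 (L2Mat A × L2Vec A)).snd

/-- `Y(A) = H¹₀(A) × [L²(A)]²`, with `‖{w, φ}‖² = ‖w‖² + ‖φ‖²`. -/
abbrev Y (A : Set Plane) : Type := WithLp 2 (H01 A × L2Vec A)

/-- `X(A) = Y(A) × H(sym, Div, A)`, with `‖{w, φ, M}‖² = ‖{w, φ}‖² + ‖M‖²`. -/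
abbrev X (A : Set Plane) : Type := WithLp 2 (Y A × HSymDiv A)

/-- `H(sym, Div, A) × [L²(A)]²`, with `‖{M, q}‖² = ‖M‖² + ‖q‖²`. -/
abbrev Z (A : Set Plane) : Type := WithLp 2 (HSymDiv A × L2Vec A)

/-- The compliance tensor `𝔸 S = (12 / E) ((1 + ν) S - ν tr(S) 1)`. -/
def compliance (E ν : ℝ) (S : Mat2) : Mat2 :=
  (12 / E) • ((1 + ν) • S -
    (ν * (S 0 0 + S 1 1)) • WithLp.toLp 2 (fun i : Fin 2 => EuclideanSpace.single i (1 : ℝ)))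

/-- The Neumann term `∫_{∂A} ⟨δM n, φ̃⟩ ds` for `δM ∈ H(sym, Div, A)` and boundary data given as the
trace of `φ̃ ∈ [H¹(A)]²`. As the normal trace of `δM` is only a distribution on the boundary, the
integral is the duality pairing given by Green's formula. -/
def neumannTerm {A : Set Plane} (δM : HSymDiv A) (φb : H1Vec A) : ℝ :=
  ∫ x in A, inner ℝ (δM.div x) (φb.val x) + inner ℝ (δM.val x) (φb.deriv x)

/-- The load `g ∈ (H¹₀(A))'` as an element `{δw, δφ} ↦ g(δw)` of `Y(A)'`. -/
def loadOnY {A : Set Plane} (g : StrongDual ℝ (H01 A)) : StrongDual ℝ (Y A) :=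
  g.comp (WithLp.fstL 2 ℝ (H01 A) (L2Vec A))

/-- `{w, φ, M}` solves the mixed problem with load `g` and boundary rotations `φb`. The load term
`∫_A δw g` is the duality pairing `g δw`; every `g₀ ∈ L²(A)` is the load
`δw ↦ ∫_A δw g₀`. -/
def IsSolution {A : Set Plane} (E ν ks μ t : ℝ) (g : StrongDual ℝ (H01 A)) (φb : H1Vec A)
    (w : H01 A) (φ : L2Vec A) (M : HSymDiv A) : Prop :=
  (∀ δM : HSymDiv A,
    ∫ x in A, (inner ℝ (δM.val x) (compliance E ν (M.val x)) + inner ℝ (δM.div x) (φ x))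
      = neumannTerm δM φb) ∧
  (∀ (δw : H01 A) (δφ : L2Vec A),
    ∫ x in A, (inner ℝ (δφ x) (M.div x) -
        (ks * μ / t ^ 2) * inner ℝ (δw.grad x - δφ x) (w.grad x - φ x))
      = -g δw)

end ReissnerMindlin

end

/-!
The mixed problem is an equation `T x = ℓ` for a bounded self-adjoint operator `T` on the Hilbert
space `X(A)`. Such an operator is bijective as soon as it is bounded below
(`surjective_of_symmetric_of_bounded_below`), so existence, uniqueness and the estimate all follow
from one stability estimate for arbitrary right-hand sides, `mixed_apriori`. Taking the solution as
test element, the two terms `⟨Div M, φ⟩` cancel, and coercivity of the compliance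
(`compliance_coercive`) controls `M` and `∇w - φ` in `L²`. The equilibrium equation then controls
`Div M`, and two facts about the bounded domain `A` control `φ` and `w`: a bounded right inverse of
`Div` on symmetric fields, and the Poincaré inequality.

Both come from the inequality `‖ψ‖ ≤ 2R ‖∂ᵢψ‖` for test functions on a set contained in the ball of
radius `R` about the origin (`norm_fst_le_of_mem_testGraph`), which is integration by parts of
`xᵢ ∂ᵢ(ψ²)`. By density it gives the Poincaré inequality on `H¹₀(A)`. By duality it gives, for every
`f ∈ L²(A)`, some `m ∈ L²(A)` with `∂ᵢm = f` weakly and `‖m‖ ≤ 2R ‖f‖`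
(`exists_weak_antiderivative`). A field `f ∈ [L²(A)]²` is then the divergence of the diagonal, hence
symmetric, matrix field with entries `m₁`, `m₂` where `∂ᵢmᵢ = fᵢ` (`exists_div_eq`); no Korn
inequality and no regularity of the boundary is needed.
-/

namespace ReissnerMindlin

/-! ### Hilbert space preliminaries -/

/-- The range is closed since `T` is bounded below, and dense since its orthogonal complement is the
kernel of the symmetric operator `T`. -/
theorem surjective_of_symmetric_of_bounded_below {X : Type*} [NormedAddCommGroup X]
    [InnerProductSpace ℝ X] [CompleteSpace X] (T : X →L[ℝ] X)
    (hsymm : ∀ x y, inner ℝ (T x) y = inner ℝ x (T y)) {C : ℝ} (hC : 0 ≤ C)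
    (hbdd : ∀ x, ‖x‖ ≤ C * ‖T x‖) : Function.Surjective T := by
  have hanti : AntilipschitzWith ⟨C, hC⟩ T :=
    ContinuousLinearMap.antilipschitz_of_bound T hbdd
  have hclosed : IsClosed (Set.range T) := hanti.isClosed_range T.uniformContinuous
  have hcl : IsClosed ((T : X →ₗ[ℝ] X).range : Set X) := hclosed
  have : CompleteSpace (T : X →ₗ[ℝ] X).range := hcl.completeSpace_coe
  have hbot : (T : X →ₗ[ℝ] X).rangeᗮ = ⊥ := by
    rw [Submodule.eq_bot_iff]
    intro y hy
    have hTy : T y = 0 := by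
      have := (Submodule.mem_orthogonal _ y).1 hy (T (T y)) ⟨T y, rfl⟩
      rw [hsymm] at this
      simpa using this
    have := hbdd y
    simpa [hTy] using this
  have htop : (T : X →ₗ[ℝ] X).range = ⊤ := (Submodule.orthogonal_eq_bot_iff).1 hbot
  exact LinearMap.range_eq_top.1 htop

/-- Absorption: a quadratic inequality whose right-hand side is linear in `e` bounds `e` by a
multiple of `η`. -/
theorem le_mul_of_mul_sq_le {γ K η e : ℝ} (hγ : 0 < γ) (hK : 0 ≤ K) (hη : 0 ≤ η)
    (h : γ * e ^ 2 ≤ η * (K * (e + η))) : e ≤ (1 + 2 * K / γ) * η := by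
  by_cases heη : e ≤ η
  · have : 0 ≤ 2 * K / γ * η := by positivity
    linarith
  · push Not at heη
    have he : 0 < e := hη.trans_lt heη
    have h₁ : γ * e ≤ 2 * K * η := by
      have : γ * e * e ≤ 2 * K * η * e := by nlinarith [mul_nonneg hη hK]
      exact le_of_mul_le_mul_right this he
    have h₂ : e ≤ 2 * K / γ * η := by
      rw [div_mul_eq_mul_div, le_div_iff₀ hγ]; linarith
    linarith

theorem norm_le_norm_fst_add_norm_snd {α β : Type*} [NormedAddCommGroup α] [NormedAddCommGroup β]
    (x : WithLp 2 (α × β)) : ‖x‖ ≤ ‖x.fst‖ + ‖x.snd‖ := by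
  refine abs_le_of_sq_le_sq' (a := ‖x‖) ?_ (by positivity) |>.2
  rw [WithLp.prod_norm_sq_eq_of_L2]
  nlinarith [mul_nonneg (norm_nonneg x.fst) (norm_nonneg x.snd)]

/-- A functional dominated by `‖T ·‖` is represented through `T` by a vector: it descends to the
range of `T`, where the theorems of Hahn–Banach and Riesz apply. -/
theorem exists_inner_eq_of_bound {E H : Type*} [AddCommGroup E] [Module ℝ E]
    [NormedAddCommGroup H] [InnerProductSpace ℝ H] [CompleteSpace H]
    (T : E →ₗ[ℝ] H) (ℓ : E →ₗ[ℝ] ℝ) {C : ℝ} (hC : 0 ≤ C) (h : ∀ e, |ℓ e| ≤ C * ‖T e‖) :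
    ∃ m : H, ‖m‖ ≤ C ∧ ∀ e, inner ℝ m (T e) = ℓ e := by
  obtain ⟨s, hs⟩ := T.rangeRestrict.exists_rightInverse_of_surjective T.range_rangeRestrict
  have hTs : ∀ y : T.range, T (s y) = y := fun y =>
    congrArg Subtype.val (LinearMap.congr_fun hs y)
  obtain ⟨f, hf, hfn⟩ := exists_extension_norm_eq T.range
    ((ℓ.comp s).mkContinuous C fun y => by
      rw [Real.norm_eq_abs]; simpa [hTs] using h (s y))
  refine ⟨(InnerProductSpace.toDual ℝ H).symm f, ?_, fun e => ?_⟩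
  · rw [LinearIsometryEquiv.norm_map, hfn]
    exact LinearMap.mkContinuous_norm_le _ hC _
  · rw [InnerProductSpace.toDual_symm_apply]
    have h₁ := hf ⟨T e, e, rfl⟩
    have h₂ := h (e - s ⟨T e, e, rfl⟩)
    rw [map_sub, map_sub, hTs, sub_self, norm_zero, mul_zero, abs_nonpos_iff, sub_eq_zero] at h₂
    rw [h₁, h₂]
    rfl

/-! ### Stability and solvability of an abstract mixed problem -/

section SaddlePoint

variable {W L N H : Type*}
  [NormedAddCommGroup W] [InnerProductSpace ℝ W]
  [NormedAddCommGroup L] [InnerProductSpace ℝ L]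
  [NormedAddCommGroup N] [InnerProductSpace ℝ N]
  [NormedAddCommGroup H] [InnerProductSpace ℝ H]

/-- The mixed equations for abstract bounded operators: `v` stands for `M ↦ M` into the matrix
fields, `d` for the divergence, `G` for the gradient, `a` for the compliance, and `F`, `P` are the
right-hand sides, defined on test elements. `P` is allowed to depend on both `δw` and `δφ`, so that these
equations describe every element of the dual of the solution space. -/
structure MixedEqs (v : H →L[ℝ] N) (d : H →L[ℝ] L) (G : W →L[ℝ] L) (a : N →L[ℝ] N) (κ : ℝ)
    (F : H → ℝ) (P : W → L → ℝ) (w : W) (φ : L) (M : H) : Prop where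
  constitutive : ∀ δM, inner ℝ (v δM) (a (v M)) + inner ℝ (d δM) φ = F δM
  equilibrium : ∀ δw δφ, inner ℝ δφ (d M) - κ * inner ℝ (G δw - δφ) (G w - φ) = P δw δφ

theorem MixedEqs.sub {v : H →L[ℝ] N} {d : H →L[ℝ] L} {G : W →L[ℝ] L} {a : N →L[ℝ] N} {κ : ℝ}
    {F F' : H → ℝ} {P P' : W → L → ℝ} {w w' : W} {φ φ' : L} {M M' : H}
    (h : MixedEqs v d G a κ F P w φ M) (h' : MixedEqs v d G a κ F' P' w' φ' M') :
    MixedEqs v d G a κ (fun δM => F δM - F' δM) (fun δw δφ => P δw δφ - P' δw δφ)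
      (w - w') (φ - φ') (M - M') := by
  refine ⟨fun δM => ?_, fun δw δφ => ?_⟩
  · rw [← h.constitutive, ← h'.constitutive]
    simp only [map_sub, inner_sub_right]
    ring
  · rw [← h.equilibrium, ← h'.equilibrium]
    simp only [map_sub, inner_sub_right]
    ring

/-- The stability estimate. Testing with the solution itself makes the off-diagonal terms cancel and
controls `v M` and `G w - φ`; the equilibrium equation controls `d M`; the right inverse of `d`
(the inf-sup condition) controls `φ`, and then the Poincaré inequality controls `w`. -/
theorem mixed_apriori (v : H →L[ℝ] N) (d : H →L[ℝ] L) (G : W →L[ℝ] L) (a : N →L[ℝ] N)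
    {κ α C : ℝ} (hκ : 0 < κ) (hα : 0 < α) (hC : 0 ≤ C)
    (hH : ∀ M, ‖M‖ ≤ ‖v M‖ + ‖d M‖)
    (hd : ∀ f, ∃ M, d M = f ∧ ‖v M‖ ≤ C * ‖f‖)
    (hG : ∀ w, ‖w‖ ≤ C * ‖G w‖)
    (ha : ∀ S, α * ‖S‖ ^ 2 ≤ inner ℝ S (a S)) :
    ∃ c : ℝ, 0 < c ∧ ∀ (F : H → ℝ) (P : W → L → ℝ) (η : ℝ), 0 ≤ η →
      (∀ δM, |F δM| ≤ η * ‖δM‖) → (∀ δw δφ, |P δw δφ| ≤ η * (‖δw‖ + ‖δφ‖)) →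
      ∀ w φ M, MixedEqs v d G a κ F P w φ M →
        ‖w‖ + ‖φ‖ + ‖v M‖ + ‖d M‖ + ‖G w - φ‖ ≤ c * η := by
  obtain ⟨A, hA0, hA⟩ : ∃ A : ℝ, 0 ≤ A ∧ ∀ S, ‖a S‖ ≤ A * ‖S‖ :=
    ⟨‖a‖, norm_nonneg _, a.le_opNorm⟩
  -- `B` bounds `‖φ‖` by `B * (‖v M‖ + η)`, and `K` bounds the sum of all five norms by
  -- `K * (‖v M‖ + ‖G w - φ‖ + η)`.
  obtain ⟨B, hB0, hB⟩ : ∃ B : ℝ, 0 ≤ B ∧ B = (1 + C) * (1 + A) := ⟨_, by positivity, rfl⟩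
  obtain ⟨K, hK0, hK⟩ : ∃ K : ℝ, 0 < K ∧ K = 2 + κ + C + B * (1 + C) := ⟨_, by positivity, rfl⟩
  have hγ : 0 < min α κ / 2 := by positivity
  refine ⟨K * (2 + 2 * K / (min α κ / 2)), by positivity, ?_⟩
  intro F P η hη hF hP w φ M hsol
  set q := G w - φ with hq
  -- The test element `δφ = d M`.
  have hb : ‖d M‖ ≤ κ * ‖q‖ + η := by
    have h₁ := hsol.equilibrium 0 (d M)
    rw [map_zero, zero_sub, inner_neg_left, real_inner_self_eq_norm_sq] at h₁
    have h₂ := (abs_le.1 (hP 0 (d M))).2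
    have h₃ := abs_le.1 (abs_real_inner_le_norm (d M) q)
    rw [norm_zero, zero_add] at h₂
    rcases (norm_nonneg (d M)).eq_or_lt with h0 | h0
    · rw [← h0]; positivity
    · refine le_of_mul_le_mul_right ?_ h0
      nlinarith [h₃.1]
  -- A test element `δM` with `d δM = φ`.
  have hf : ‖φ‖ ≤ B * (‖v M‖ + η) := by
    obtain ⟨δM, h₁, h₂⟩ := hd φ
    have h₃ := hsol.constitutive δM
    rw [h₁, real_inner_self_eq_norm_sq] at h₃
    have h₄ := (abs_le.1 (hF δM)).2
    have h₅ := (abs_le.1 (abs_real_inner_le_norm (v δM) (a (v M)))).1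
    have h₆ : ‖δM‖ ≤ (C + 1) * ‖φ‖ := (hH δM).trans (by rw [h₁]; linarith)
    have h₇ : ‖v δM‖ * ‖a (v M)‖ ≤ (C * ‖φ‖) * (A * ‖v M‖) := by gcongr; exact hA _
    have h₈ : η * ‖δM‖ ≤ η * ((C + 1) * ‖φ‖) := by gcongr
    have h₉ : ‖φ‖ ≤ (C + 1) * η + C * (A * ‖v M‖) := by
      rcases (norm_nonneg φ).eq_or_lt with h0 | h0
      · rw [← h0]; positivity
      · refine le_of_mul_le_mul_right ?_ h0
        nlinarith
    have e₁ : 0 ≤ (1 + C) * A * η := by positivity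
    have e₂ : 0 ≤ (1 + C + A) * ‖v M‖ := by positivity
    rw [hB]
    linarith
  have hu : ‖w‖ ≤ C * (‖q‖ + ‖φ‖) := by
    refine (hG w).trans (mul_le_mul_of_nonneg_left ?_ hC)
    calc ‖G w‖ = ‖q + φ‖ := by rw [hq, sub_add_cancel]
      _ ≤ _ := norm_add_le _ _
  have hsum : ‖w‖ + ‖φ‖ + ‖v M‖ + ‖d M‖ + ‖q‖ ≤ K * (‖v M‖ + ‖q‖ + η) := by
    have h₁ : ‖w‖ ≤ C * (‖q‖ + B * (‖v M‖ + η)) := hu.trans (by gcongr)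
    have e₁ : 0 ≤ (κ + C) * ‖v M‖ := by positivity
    have e₂ : 0 ≤ B * (1 + C) * ‖q‖ := by positivity
    have e₃ : 0 ≤ (κ + C) * η := by positivity
    have e₄ := norm_nonneg (v M)
    have e₅ := norm_nonneg q
    rw [hK]
    linarith
  -- The solution itself as test element; `⟨d M, φ⟩` drops out of the difference.
  have henergy : min α κ / 2 * (‖v M‖ + ‖q‖) ^ 2 ≤ η * (K * (‖v M‖ + ‖q‖ + η)) := by
    have h₁ := hsol.constitutive M
    have h₂ := hsol.equilibrium w φ
    rw [real_inner_self_eq_norm_sq] at h₂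
    rw [real_inner_comm φ (d M)] at h₁
    have h₃ := (abs_le.1 (hF M)).2
    have h₄ := (abs_le.1 (hP w φ)).1
    have h₅ := ha (v M)
    have h₆ : η * ‖M‖ ≤ η * (‖v M‖ + ‖d M‖) := by gcongr; exact hH M
    have h₇ : η * (‖w‖ + ‖φ‖ + ‖v M‖ + ‖d M‖) ≤ η * (K * (‖v M‖ + ‖q‖ + η)) := by
      gcongr; linarith [norm_nonneg q]
    have h₈ : min α κ * ‖v M‖ ^ 2 ≤ α * ‖v M‖ ^ 2 := by gcongr; exact min_le_left _ _
    have h₉ : min α κ * ‖q‖ ^ 2 ≤ κ * ‖q‖ ^ 2 := by gcongr; exact min_le_right _ _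
    have h₁₀ : 0 ≤ min α κ * (‖v M‖ - ‖q‖) ^ 2 := by positivity
    linarith
  have he := le_mul_of_mul_sq_le hγ hK0.le hη henergy
  calc _ ≤ K * (‖v M‖ + ‖q‖ + η) := hsum
    _ ≤ K * ((1 + 2 * K / (min α κ / 2)) * η + η) := by gcongr
    _ = _ := by ring

variable [CompleteSpace W] [CompleteSpace L] [CompleteSpace N] [CompleteSpace H]

/-- The operator of the mixed problem is self-adjoint, and `mixed_apriori`, applied to all
right-hand sides in the dual of the solution space, says that it is bounded below. Hence it is onto. -/
theorem mixed_exists (v : H →L[ℝ] N) (d : H →L[ℝ] L) (G : W →L[ℝ] L) (a : N →L[ℝ] N)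
    {κ α C : ℝ} (hκ : 0 < κ) (hα : 0 < α) (hC : 0 ≤ C)
    (hH : ∀ M, ‖M‖ ≤ ‖v M‖ + ‖d M‖)
    (hd : ∀ f, ∃ M, d M = f ∧ ‖v M‖ ≤ C * ‖f‖)
    (hG : ∀ w, ‖w‖ ≤ C * ‖G w‖)
    (ha : ∀ S, α * ‖S‖ ^ 2 ≤ inner ℝ S (a S))
    (hsymm : ∀ S S', inner ℝ (a S) S' = inner ℝ S (a S'))
    (F : StrongDual ℝ H) (g : StrongDual ℝ W) :
    ∃ w φ M, MixedEqs v d G a κ F (fun δw _ => -g δw) w φ M := by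
  -- `T` is the Riesz representation of the bilinear form of the two equations added together.
  let pM : WithLp 2 (WithLp 2 (W × L) × H) →L[ℝ] H := WithLp.sndL 2 ℝ _ _
  let pw : WithLp 2 (WithLp 2 (W × L) × H) →L[ℝ] W :=
    (WithLp.fstL 2 ℝ W L).comp (WithLp.fstL 2 ℝ _ _)
  let pφ : WithLp 2 (WithLp 2 (W × L) × H) →L[ℝ] L :=
    (WithLp.sndL 2 ℝ W L).comp (WithLp.fstL 2 ℝ _ _)
  let R := v.comp pM
  let D := d.comp pM
  let Q := G.comp pw - pφ
  let T := R.adjoint.comp (a.comp R) + D.adjoint.comp pφ + pφ.adjoint.comp D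
    - κ • Q.adjoint.comp Q
  have hT : ∀ x y, inner ℝ (T x) y = inner ℝ (a (v x.snd)) (v y.snd) + inner ℝ x.fst.snd (d y.snd)
      + inner ℝ (d x.snd) y.fst.snd
      - κ * inner ℝ (G x.fst.fst - x.fst.snd) (G y.fst.fst - y.fst.snd) := by
    intro x y
    simp only [T, _root_.add_apply, _root_.sub_apply, _root_.smul_apply,
      ContinuousLinearMap.comp_apply, inner_add_left,
      inner_sub_left (_ + _), real_inner_smul_left, ContinuousLinearMap.adjoint_inner_left]
    rfl
  have hTsymm : ∀ x y, inner ℝ (T x) y = inner ℝ x (T y) := by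
    intro x y
    rw [← real_inner_comm x, hT, hT, hsymm, real_inner_comm _ (v x.snd), real_inner_comm x.fst.snd,
      real_inner_comm (d x.snd), real_inner_comm (G x.fst.fst - x.fst.snd)]
    ring
  have hsol : ∀ x, MixedEqs v d G a κ (fun δM => inner ℝ (T x) (WithLp.toLp 2 (0, δM)))
      (fun δw δφ => inner ℝ (T x) (WithLp.toLp 2 (WithLp.toLp 2 (δw, δφ), 0)))
      x.fst.fst x.fst.snd x.snd := by
    refine fun x => ⟨fun δM => ?_, fun δw δφ => ?_⟩
    · rw [hT]
      simp [real_inner_comm]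
    · rw [hT]
      simp [real_inner_comm]
  obtain ⟨c, hc, hest⟩ := mixed_apriori v d G a hκ hα hC hH hd hG ha
  have hbdd : ∀ x, ‖x‖ ≤ c * ‖T x‖ := by
    intro x
    have h := hest _ _ ‖T x‖ (norm_nonneg _) (fun δM => ?_) (fun δw δφ => ?_) _ _ _ (hsol x)
    · linarith [norm_le_norm_fst_add_norm_snd x, norm_le_norm_fst_add_norm_snd x.fst, hH x.snd,
        norm_nonneg (G x.fst.fst - x.fst.snd)]
    · refine (abs_real_inner_le_norm _ _).trans ?_
      gcongr
      simp
    · refine (abs_real_inner_le_norm _ _).trans ?_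
      gcongr
      refine (norm_le_norm_fst_add_norm_snd _).trans ?_
      simpa using norm_le_norm_fst_add_norm_snd (WithLp.toLp 2 (δw, δφ))
  obtain ⟨x, hx⟩ := surjective_of_symmetric_of_bounded_below T hTsymm hc.le hbdd
    ((InnerProductSpace.toDual ℝ _).symm (F.comp pM - g.comp pw))
  have hx' : ∀ y, inner ℝ (T x) y = F y.snd - g y.fst.fst := by
    intro y
    rw [hx, InnerProductSpace.toDual_symm_apply]
    rfl
  refine ⟨x.fst.fst, x.fst.snd, x.snd, fun δM => ?_, fun δw δφ => ?_⟩
  · rw [(hsol x).constitutive, hx']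
    simp
  · rw [(hsol x).equilibrium, hx']
    simp

end SaddlePoint

/-! ### The Poincaré inequality -/

section Concrete

variable {A : Set Plane}

/-- The map `v ↦ vᵢ` from `[L²(A)]²` to `L²(A)`. -/
noncomputable def coordL (A : Set Plane) (i : Fin 2) : L2Vec A →L[ℝ] L2 A :=
  (EuclideanSpace.proj (𝕜 := ℝ) i : Plane →L[ℝ] ℝ).compLpL 2 _

/-- The map sending a matrix field in `[L²(A)]^(2×2)` to its `i`-th row. -/
noncomputable def rowL (A : Set Plane) (i : Fin 2) : L2Mat A →L[ℝ] L2Vec A :=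
  (PiLp.proj (𝕜 := ℝ) 2 (fun _ : Fin 2 => Plane) i).compLpL 2 _

theorem coeFn_coordL (v : L2Vec A) (i : Fin 2) :
    coordL A i v =ᵐ[volume.restrict A] fun x => v x i :=
  ContinuousLinearMap.coeFn_compLpL _ v

theorem coeFn_rowL (M : L2Mat A) (i : Fin 2) :
    rowL A i M =ᵐ[volume.restrict A] fun x => M x i :=
  ContinuousLinearMap.coeFn_compLpL _ M

theorem norm_coordL_le (v : L2Vec A) (i : Fin 2) : ‖coordL A i v‖ ≤ ‖v‖ := by
  refine Lp.norm_le_norm_of_ae_le ?_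
  filter_upwards [coeFn_coordL v i] with x hx
  rw [hx]
  exact PiLp.norm_apply_le (v x) i

theorem gradient_apply (ψ : Plane → ℝ) (x : Plane) (i : Fin 2) :
    (∇ ψ x) i = fderiv ℝ ψ x (EuclideanSpace.single i 1) := by
  rw [← inner_gradient_left, EuclideanSpace.inner_single_right]
  simp

theorem IsTest.eq_zero_of_notMem {ψ : Plane → ℝ} (hψ : IsTest A ψ) {x : Plane} (hx : x ∉ A) :
    ψ x = 0 :=
  image_eq_zero_of_notMem_tsupport fun h => hx (hψ.2.2 h)

/-- Integration by parts of `xᵢ ∂ᵢ(ψ²)`, the source of the Poincaré inequality. -/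
theorem IsTest.integral_sq {ψ : Plane → ℝ} (hψ : IsTest A ψ) (i : Fin 2) :
    ∫ x in A, ψ x * ψ x = -2 * ∫ x in A, (x i * ψ x) * (∇ ψ x) i := by
  have hc := hψ.1.continuous
  have hdc : Continuous fun x => fderiv ℝ ψ x (EuclideanSpace.single i 1) :=
    (hψ.1.continuous_fderiv (by simp)).clm_apply continuous_const
  have hxc : Continuous fun x : Plane => x i := (EuclideanSpace.proj (𝕜 := ℝ) i).continuous
  have hfx : ∀ x : Plane, fderiv ℝ (fun x : Plane => x i) x (EuclideanSpace.single i 1) = 1 := by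
    intro x
    have := (EuclideanSpace.proj (𝕜 := ℝ) i : Plane →L[ℝ] ℝ).fderiv (x := x)
    change fderiv ℝ (EuclideanSpace.proj (𝕜 := ℝ) i : Plane →L[ℝ] ℝ) x _ = 1
    rw [this]
    simp
  have hg : ∀ x, fderiv ℝ (fun x => ψ x * ψ x) x (EuclideanSpace.single i 1)
      = 2 * (ψ x * fderiv ℝ ψ x (EuclideanSpace.single i 1)) := by
    intro x
    rw [fderiv_fun_mul (hψ.differentiable x) (hψ.differentiable x)]
    simp
    ring
  have key := integral_mul_fderiv_eq_neg_fderiv_mul_of_integrable (μ := (volume : Measure Plane))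
    (f := fun x : Plane => x i) (g := fun x => ψ x * ψ x) (v := EuclideanSpace.single i (1 : ℝ))
    ?_ ?_ ?_ ?_ ?_
  · simp only [hfx, one_mul, hg] at key
    rw [setIntegral_eq_integral_of_forall_compl_eq_zero
        (fun x hx => by rw [hψ.eq_zero_of_notMem hx, mul_zero]),
      setIntegral_eq_integral_of_forall_compl_eq_zero
        (fun x hx => by rw [hψ.eq_zero_of_notMem hx, mul_zero, zero_mul]),
      ← neg_eq_iff_eq_neg.2 key, neg_mul, ← integral_const_mul]
    congr 2
    ext x
    rw [gradient_apply]
    ring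
  · simp only [hfx, one_mul]
    exact (hc.mul hc).integrable_of_hasCompactSupport hψ.2.1.mul_left
  · simp only [hg]
    exact (hxc.mul (continuous_const.mul (hc.mul hdc))).integrable_of_hasCompactSupport
      (hψ.2.1.mul_right.mul_left.mul_left)
  · exact (hxc.mul (hc.mul hc)).integrable_of_hasCompactSupport hψ.2.1.mul_left.mul_left
  · exact fun x _ => (EuclideanSpace.proj (𝕜 := ℝ) i : Plane →L[ℝ] ℝ).differentiableAt
  · exact fun x _ => (hψ.differentiable x).mul (hψ.differentiable x)

/-- The Poincaré inequality for test functions, with only one partial derivative on the right. -/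
theorem norm_fst_le_of_mem_testGraph (hA : MeasurableSet A) {R : ℝ} (hR₀ : 0 ≤ R)
    (hR : ∀ x ∈ A, ‖x‖ ≤ R) (i : Fin 2) {p : WithLp 2 (L2 A × L2Vec A)} (hp : p ∈ testGraph A) :
    ‖p.fst‖ ≤ 2 * R * ‖coordL A i p.snd‖ := by
  obtain ⟨ψ, hψ, h₁, h₂⟩ := hp
  have hxc : Continuous fun x : Plane => x i := (EuclideanSpace.proj (𝕜 := ℝ) i).continuous
  have hm : MemLp (fun x => x i * ψ x) 2 (volume.restrict A) :=
    ((hxc.mul hψ.1.continuous).memLp_of_hasCompactSupport hψ.2.1.mul_left).restrict A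
  have hmn : ‖hm.toLp‖ ≤ R * ‖p.fst‖ := by
    refine Lp.norm_le_mul_norm_of_ae_le_mul ?_
    filter_upwards [hm.coeFn_toLp, h₁, ae_restrict_mem hA] with x e₁ e₂ hx
    rw [e₁, e₂, norm_mul]
    gcongr
    exact (PiLp.norm_apply_le x i).trans (hR x hx)
  have key : ‖p.fst‖ ^ 2 = -2 * inner ℝ hm.toLp (coordL A i p.snd) := by
    rw [← real_inner_self_eq_norm_sq, L2.inner_def, L2.inner_def]
    have e₁ : ∫ x in A, inner ℝ (p.fst x) (p.fst x) = ∫ x in A, ψ x * ψ x :=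
      integral_congr_ae (by filter_upwards [h₁] with x hx; rw [hx]; simp [sq])
    have e₂ : ∫ x in A, inner ℝ ((hm.toLp : L2 A) x) (coordL A i p.snd x)
        = ∫ x in A, (x i * ψ x) * (∇ ψ x) i :=
      integral_congr_ae (by
        filter_upwards [hm.coeFn_toLp, coeFn_coordL p.snd i, h₂] with x k₁ k₂ k₃
        rw [k₁, k₂, k₃]; simp [mul_comm])
    rw [e₁, e₂, hψ.integral_sq i]
  have h₃ := (abs_le.1 (abs_real_inner_le_norm hm.toLp (coordL A i p.snd))).1
  have h₄ : ‖hm.toLp‖ * ‖coordL A i p.snd‖ ≤ R * ‖p.fst‖ * ‖coordL A i p.snd‖ := by gcongr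
  rcases (norm_nonneg p.fst).eq_or_lt with h0 | h0
  · rw [← h0]
    positivity
  · refine le_of_mul_le_mul_right ?_ h0
    nlinarith

/-- The Poincaré inequality on `H¹₀(A)`, by density of the test functions. -/
theorem H01.norm_val_le (hA : MeasurableSet A) {R : ℝ} (hR₀ : 0 ≤ R) (hR : ∀ x ∈ A, ‖x‖ ≤ R)
    (w : H01 A) : ‖w.val‖ ≤ 2 * R * ‖w.grad‖ := by
  have hcl : IsClosed {p : WithLp 2 (L2 A × L2Vec A) | ‖p.fst‖ ≤ 2 * R * ‖p.snd‖} :=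
    isClosed_le (WithLp.fstL 2 ℝ (L2 A) (L2Vec A)).continuous.norm
      (continuous_const.mul (WithLp.sndL 2 ℝ (L2 A) (L2Vec A)).continuous.norm)
  refine closure_minimal (fun p hp => ?_) hcl w.2
  refine (norm_fst_le_of_mem_testGraph hA hR₀ hR 0 hp).trans ?_
  gcongr
  exact norm_coordL_le _ _

/-! ### Completeness of `H(sym, Div, A)` -/

/-- A weak divergence in `L²` is characterized by `L²` inner products that depend continuously on
the field and its divergence. -/
theorem hasWeakDiv_iff (v : L2Vec A) (d : L2 A) :
    HasWeakDiv A v d ↔ ∀ q ∈ testGraph A, inner ℝ v q.snd = -inner ℝ q.fst d := by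
  have key : ∀ (ψ : Plane → ℝ) (q : WithLp 2 (L2 A × L2Vec A)),
      q.fst =ᵐ[volume.restrict A] ψ → q.snd =ᵐ[volume.restrict A] ∇ ψ →
      (inner ℝ v q.snd = ∫ x in A, inner ℝ (v x) (∇ ψ x)) ∧
        inner ℝ q.fst d = ∫ x in A, ψ x * d x := by
    intro ψ q h₁ h₂
    rw [L2.inner_def, L2.inner_def]
    constructor
    · exact integral_congr_ae (by filter_upwards [h₂] with x hx; rw [hx])
    · exact integral_congr_ae (by filter_upwards [h₁] with x hx; rw [hx]; simp [mul_comm])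
  constructor
  · rintro h q ⟨ψ, hψ, h₁, h₂⟩
    rw [(key ψ q h₁ h₂).1, (key ψ q h₁ h₂).2, h ψ hψ]
  · intro h ψ hψ
    have h₁ := hψ.memLp.coeFn_toLp
    have h₂ := hψ.memLp_grad.coeFn_toLp
    have k := key ψ (WithLp.toLp 2 (hψ.memLp.toLp, hψ.memLp_grad.toLp)) h₁ h₂
    rw [← k.1, ← k.2]
    exact h _ ⟨ψ, hψ, h₁, h₂⟩

/-- The conditions defining `H(sym, Div, A)`, written as equations between continuous functions of
the pair `(M, Div M)`. -/
theorem mem_hSymDivGraph_iff (p : WithLp 2 (L2Mat A × L2Vec A)) :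
    p ∈ hSymDivGraph A ↔
      (∀ i j : Fin 2, coordL A j (rowL A i p.fst) = coordL A i (rowL A j p.fst)) ∧
      ∀ i : Fin 2, ∀ q ∈ testGraph A,
        inner ℝ (rowL A i p.fst) q.snd = -inner ℝ q.fst (coordL A i p.snd) := by
  have hc : ∀ i j : Fin 2, coordL A j (rowL A i p.fst) =ᵐ[volume.restrict A]
      fun x => p.fst x i j := by
    intro i j
    filter_upwards [coeFn_coordL (rowL A i p.fst) j, coeFn_rowL p.fst i] with x h₁ h₂
    rw [h₁, h₂]
  refine and_congr ⟨fun h i j => ?_, fun h => ?_⟩ (forall_congr' fun i => ?_)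
  · apply Lp.ext
    filter_upwards [hc i j, hc j i, h] with x h₁ h₂ h₃
    rw [h₁, h₂, h₃]
  · rw [ae_all_iff]
    refine fun i => ae_all_iff.2 fun j => ?_
    filter_upwards [hc i j, hc j i] with x h₁ h₂
    rw [← h₁, ← h₂, h i j]
  · rw [← hasWeakDiv_iff]
    exact ⟨fun h => h.congr (coeFn_rowL _ _).symm (coeFn_coordL _ _).symm,
      fun h => h.congr (coeFn_rowL _ _) (coeFn_coordL _ _)⟩

theorem isClosed_hSymDivGraph : IsClosed (hSymDivGraph A : Set (WithLp 2 (L2Mat A × L2Vec A))) := by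
  have h₁ := (WithLp.fstL 2 ℝ (L2Mat A) (L2Vec A)).continuous
  have h₂ := (WithLp.sndL 2 ℝ (L2Mat A) (L2Vec A)).continuous
  have h : (hSymDivGraph A : Set (WithLp 2 (L2Mat A × L2Vec A))) = {p |
      (∀ i j : Fin 2, coordL A j (rowL A i p.fst) = coordL A i (rowL A j p.fst)) ∧
      ∀ i : Fin 2, ∀ q ∈ testGraph A,
        inner ℝ (rowL A i p.fst) q.snd = -inner ℝ q.fst (coordL A i p.snd)} :=
    Set.ext mem_hSymDivGraph_iff
  rw [h]
  simp only [Set.ofPred_and, Set.ofPred_forall]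
  refine IsClosed.inter (isClosed_iInter fun i => isClosed_iInter fun j => ?_)
    (isClosed_iInter fun i => isClosed_iInter fun q => isClosed_iInter fun _ => ?_)
  · exact isClosed_eq ((coordL A j).continuous.comp ((rowL A i).continuous.comp h₁))
      ((coordL A i).continuous.comp ((rowL A j).continuous.comp h₁))
  · exact isClosed_eq (((rowL A i).continuous.comp h₁).inner continuous_const)
      (continuous_const.inner ((coordL A i).continuous.comp h₂)).neg

instance : CompleteSpace (HSymDiv A) := isClosed_hSymDivGraph.completeSpace_coe

/-! ### A right inverse of the divergence -/

/-- Every `f ∈ L²(A)` is a weak partial derivative `∂ᵢ m` with `m ∈ L²(A)`, bounded by `f`: this is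
dual to the Poincaré inequality in direction `i`. -/
theorem exists_weak_antiderivative (hA : MeasurableSet A) {R : ℝ} (hR₀ : 0 ≤ R)
    (hR : ∀ x ∈ A, ‖x‖ ≤ R) (i : Fin 2) (f : L2 A) :
    ∃ m : L2 A, ‖m‖ ≤ 2 * R * ‖f‖ ∧
      ∀ q ∈ testGraph A, inner ℝ m (coordL A i q.snd) = -inner ℝ q.fst f := by
  have hbound (q : testGraph A) : |-inner ℝ f q.1.fst| ≤ 2 * R * ‖f‖ * ‖coordL A i q.1.snd‖ := by
    rw [abs_neg]
    refine (abs_real_inner_le_norm _ _).trans ?_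
    have := mul_le_mul_of_nonneg_left (norm_fst_le_of_mem_testGraph hA hR₀ hR i q.2)
      (norm_nonneg f)
    linarith
  obtain ⟨m, hm, h⟩ := exists_inner_eq_of_bound
    (((coordL A i).comp (WithLp.sndL 2 ℝ (L2 A) (L2Vec A))).toLinearMap.comp (testGraph A).subtype)
    ((-(innerSL ℝ f).comp (WithLp.fstL 2 ℝ (L2 A) (L2Vec A))).toLinearMap.comp
      (testGraph A).subtype) (C := 2 * R * ‖f‖) (by positivity) hbound
  refine ⟨m, hm, fun q hq => ?_⟩
  rw [real_inner_comm f]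
  exact h ⟨q, hq⟩

/-- The map sending a number `s` to the matrix whose only nonzero entry is `s`, at the `i`-th place
of the diagonal. -/
noncomputable def diagEntry (i : Fin 2) : ℝ →L[ℝ] Mat2 where
  toFun s := WithLp.toLp 2 fun j => WithLp.toLp 2 fun k => if j = i ∧ k = i then s else 0
  map_add' s r := by
    ext j k
    simp only [PiLp.add_apply]
    split_ifs <;> simp
  map_smul' c s := by
    ext j k
    simp
  cont := by
    refine (PiLp.continuous_toLp 2 _).comp (continuous_pi fun j =>
      (PiLp.continuous_toLp 2 _).comp (continuous_pi fun k => ?_))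
    split_ifs <;> fun_prop

theorem diagEntry_apply (i j k : Fin 2) (s : ℝ) :
    diagEntry i s j k = if j = i ∧ k = i then s else 0 := rfl

/-- The map sending `m ∈ L²(A)` to the matrix field whose only nonzero entry is `m`, at the `i`-th
place of the diagonal. -/
noncomputable def diagL (A : Set Plane) (i : Fin 2) : L2 A →L[ℝ] L2Mat A :=
  (diagEntry i).compLpL 2 _

theorem coeFn_rowL_diagL (i j : Fin 2) (m : L2 A) :
    rowL A j (diagL A i m) =ᵐ[volume.restrict A] fun x => diagEntry i (m x) j := by
  filter_upwards [coeFn_rowL (diagL A i m) j, (diagEntry i).coeFn_compLpL m] with x h₁ h₂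
  rw [h₁, diagL, h₂]

theorem inner_rowL_diagL_same (i : Fin 2) (m : L2 A) (v : L2Vec A) :
    inner ℝ (rowL A i (diagL A i m)) v = inner ℝ m (coordL A i v) := by
  rw [L2.inner_def, L2.inner_def]
  refine integral_congr_ae ?_
  filter_upwards [coeFn_rowL_diagL i i m, coeFn_coordL v i] with x h₁ h₂
  rw [h₁, h₂, PiLp.inner_apply]
  simp [diagEntry_apply]

theorem rowL_diagL_of_ne {i j : Fin 2} (hij : i ≠ j) (m : L2 A) : rowL A i (diagL A j m) = 0 := by
  apply Lp.ext
  filter_upwards [coeFn_rowL_diagL j i m, Lp.coeFn_zero Plane 2 (volume.restrict A)] with x h₁ h₂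
  rw [h₁, h₂]
  ext k
  simp [diagEntry_apply, hij]

theorem coordL_rowL_diagL_of_ne {i j k : Fin 2} (hij : i ≠ j) (m : L2 A) :
    coordL A i (rowL A j (diagL A k m)) = 0 := by
  apply Lp.ext
  filter_upwards [coeFn_coordL (rowL A j (diagL A k m)) i, coeFn_rowL_diagL k j m,
    Lp.coeFn_zero ℝ 2 (volume.restrict A)] with x h₁ h₂ h₃
  rw [h₁, h₂, h₃, diagEntry_apply, if_neg fun h => hij (h.2.trans h.1.symm)]
  rfl

/-- A bounded right inverse of `Div` on symmetric fields: for `∂ᵢ mᵢ = fᵢ` the diagonal field with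
entries `mᵢ` is symmetric and has divergence `f`. -/
theorem exists_div_eq (hA : MeasurableSet A) {R : ℝ} (hR₀ : 0 ≤ R) (hR : ∀ x ∈ A, ‖x‖ ≤ R)
    (f : L2Vec A) : ∃ M : HSymDiv A, M.div = f ∧
      ‖M.val‖ ≤ (∑ i, ‖diagL A i‖) * (2 * R) * ‖f‖ := by
  choose m hm hmq using fun i => exists_weak_antiderivative hA hR₀ hR i (coordL A i f)
  have hrow : ∀ i, rowL A i (∑ k, diagL A k (m k)) = rowL A i (diagL A i (m i)) := by
    intro i
    rw [map_sum, Finset.sum_eq_single i (fun k _ hk => rowL_diagL_of_ne hk.symm _) (by simp)]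
  refine ⟨⟨WithLp.toLp 2 (∑ k, diagL A k (m k), f), ?_⟩, rfl, ?_⟩
  · rw [mem_hSymDivGraph_iff]
    refine ⟨fun i j => ?_, fun i q hq => ?_⟩
    · by_cases hij : i = j
      · rw [hij]
      · change coordL A j (rowL A i (∑ k, diagL A k (m k))) =
          coordL A i (rowL A j (∑ k, diagL A k (m k)))
        rw [hrow, hrow, coordL_rowL_diagL_of_ne hij, coordL_rowL_diagL_of_ne (Ne.symm hij)]
    · change inner ℝ (rowL A i (∑ k, diagL A k (m k))) q.snd = _
      rw [hrow, inner_rowL_diagL_same, hmq i q hq]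
      rfl
  · change ‖∑ k, diagL A k (m k)‖ ≤ _
    rw [Finset.sum_mul, Finset.sum_mul]
    refine norm_sum_le_of_le _ fun i _ => ((diagL A i).le_opNorm _).trans ?_
    rw [mul_assoc]
    gcongr
    refine (hm i).trans ?_
    gcongr
    exact norm_coordL_le f i

/-! ### The compliance tensor -/

/-- The compliance tensor as a continuous linear map on matrices. -/
noncomputable def complianceL (E ν : ℝ) : Mat2 →L[ℝ] Mat2 where
  toFun := compliance E ν
  map_add' S T := by
    ext i j
    simp only [compliance, PiLp.add_apply, PiLp.smul_apply, PiLp.sub_apply, smul_eq_mul]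
    ring
  map_smul' c S := by
    ext i j
    simp only [compliance, PiLp.smul_apply, PiLp.sub_apply, smul_eq_mul, RingHom.id_apply]
    ring
  cont := by
    unfold compliance
    fun_prop

theorem complianceL_apply (E ν : ℝ) (S : Mat2) : complianceL E ν S = compliance E ν S := rfl

theorem inner_compliance (E ν : ℝ) (S T : Mat2) :
    inner ℝ S (compliance E ν T) =
      12 / E * ((1 + ν) * inner ℝ S T - ν * (S 0 0 + S 1 1) * (T 0 0 + T 1 1)) := by
  simp [compliance, PiLp.inner_apply, Fin.sum_univ_two]
  ring

theorem compliance_coercive {E ν : ℝ} (hE : 0 < E) (S : Mat2) :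
    12 / E * min (1 - ν) (1 + ν) * ‖S‖ ^ 2 ≤ inner ℝ S (compliance E ν S) := by
  have hn : ‖S‖ ^ 2 = S 0 0 ^ 2 + S 0 1 ^ 2 + S 1 0 ^ 2 + S 1 1 ^ 2 := by
    rw [← real_inner_self_eq_norm_sq, PiLp.inner_apply]
    simp only [PiLp.inner_apply, Fin.sum_univ_two, RCLike.inner_apply, conj_trivial]
    ring
  -- `(tr S)² ≤ 2 |S|²`, so the worst case is `1 - ν` for `ν ≥ 0` and `1 + ν` for `ν ≤ 0`.
  have htr : (S 0 0 + S 1 1) ^ 2 ≤ 2 * ‖S‖ ^ 2 := by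
    rw [hn]
    nlinarith [sq_nonneg (S 0 0 - S 1 1), sq_nonneg (S 0 1), sq_nonneg (S 1 0)]
  rw [inner_compliance, mul_assoc, real_inner_self_eq_norm_sq]
  gcongr
  rcases le_total 0 ν with hν | hν
  · have h₁ := mul_le_mul_of_nonneg_right (min_le_left (1 - ν) (1 + ν)) (sq_nonneg ‖S‖)
    have h₂ := mul_le_mul_of_nonneg_left htr hν
    linarith
  · have h₁ := mul_le_mul_of_nonneg_right (min_le_right (1 - ν) (1 + ν)) (sq_nonneg ‖S‖)
    have h₂ := mul_nonneg (neg_nonneg.2 hν) (sq_nonneg (S 0 0 + S 1 1))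
    linarith

theorem compLpL_coercive {F : Type*} [NormedAddCommGroup F] [InnerProductSpace ℝ F]
    {μ : Measure Plane} (a : F →L[ℝ] F) {α : ℝ} (h : ∀ S, α * ‖S‖ ^ 2 ≤ inner ℝ S (a S))
    (S : Lp F 2 μ) : α * ‖S‖ ^ 2 ≤ inner ℝ S (a.compLpL 2 μ S) := by
  rw [← real_inner_self_eq_norm_sq, L2.inner_def, L2.inner_def, ← integral_const_mul]
  refine integral_mono_ae ((L2.integrable_inner (𝕜 := ℝ) S S).const_mul α)
    (L2.integrable_inner (𝕜 := ℝ) _ _) ?_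
  filter_upwards [a.coeFn_compLpL S] with x hx
  rw [hx, real_inner_self_eq_norm_sq]
  exact h _

theorem compLpL_symm {F : Type*} [NormedAddCommGroup F] [InnerProductSpace ℝ F]
    {μ : Measure Plane} (a : F →L[ℝ] F) (h : ∀ S T, inner ℝ (a S) T = inner ℝ S (a T))
    (S T : Lp F 2 μ) : inner ℝ (a.compLpL 2 μ S) T = inner ℝ S (a.compLpL 2 μ T) := by
  rw [L2.inner_def, L2.inner_def]
  refine integral_congr_ae ?_
  filter_upwards [a.coeFn_compLpL S, a.coeFn_compLpL T] with x h₁ h₂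
  rw [h₁, h₂, h]

/-! ### The plate problem as an abstract mixed problem -/

/-- The map `M ↦ M` from `H(sym, Div, A)` to `[L²(A)]^(2×2)`. -/
noncomputable def valL (A : Set Plane) : HSymDiv A →L[ℝ] L2Mat A :=
  (WithLp.fstL 2 ℝ (L2Mat A) (L2Vec A)).comp (hSymDivGraph A).subtypeL

/-- The map `M ↦ Div M` from `H(sym, Div, A)` to `[L²(A)]²`. -/
noncomputable def divL (A : Set Plane) : HSymDiv A →L[ℝ] L2Vec A :=
  (WithLp.sndL 2 ℝ (L2Mat A) (L2Vec A)).comp (hSymDivGraph A).subtypeL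

/-- The map `w ↦ ∇w` from `H¹₀(A)` to `[L²(A)]²`. -/
noncomputable def gradL (A : Set Plane) : H01 A →L[ℝ] L2Vec A :=
  (WithLp.sndL 2 ℝ (L2 A) (L2Vec A)).comp (testGraph A).topologicalClosure.subtypeL

/-- The Neumann term as a bounded functional of the test field. -/
noncomputable def neumannDual (φb : H1Vec A) : StrongDual ℝ (HSymDiv A) :=
  (innerSL ℝ φb.val).comp (divL A) + (innerSL ℝ φb.deriv).comp (valL A)

theorem neumannDual_apply (φb : H1Vec A) (δM : HSymDiv A) :
    neumannDual φb δM = neumannTerm δM φb := by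
  rw [neumannTerm, integral_add (L2.integrable_inner (𝕜 := ℝ) δM.div φb.val)
    (L2.integrable_inner (𝕜 := ℝ) δM.val φb.deriv), ← L2.inner_def, ← L2.inner_def,
    real_inner_comm φb.val, real_inner_comm φb.deriv]
  rfl

theorem abs_neumannTerm_le (δM : HSymDiv A) (φb : H1Vec A) :
    |neumannTerm δM φb| ≤ 2 * ‖φb‖ * ‖δM‖ := by
  have h₁ : ‖φb.val‖ ≤ ‖φb‖ := WithLp.norm_fst_le _ _
  have h₂ : ‖φb.deriv‖ ≤ ‖φb‖ := WithLp.norm_snd_le _ _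
  have h₃ : ‖δM.val‖ ≤ ‖δM‖ := WithLp.norm_fst_le _ _
  have h₄ : ‖δM.div‖ ≤ ‖δM‖ := WithLp.norm_snd_le _ _
  rw [← neumannDual_apply]
  change |inner ℝ φb.val δM.div + inner ℝ φb.deriv δM.val| ≤ _
  refine (abs_add_le _ _).trans ?_
  have h₅ := abs_real_inner_le_norm φb.val δM.div
  have h₆ := abs_real_inner_le_norm φb.deriv δM.val
  have h₇ : ‖φb.val‖ * ‖δM.div‖ ≤ ‖φb‖ * ‖δM‖ := by gcongr
  have h₈ : ‖φb.deriv‖ * ‖δM.val‖ ≤ ‖φb‖ * ‖δM‖ := by gcongr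
  linarith

/-- The concrete problem is the abstract one; the integrals split since all fields are in `L²`. -/
theorem isSolution_iff {E ν ks μ t : ℝ} {g : StrongDual ℝ (H01 A)} {φb : H1Vec A}
    {w : H01 A} {φ : L2Vec A} {M : HSymDiv A} :
    IsSolution E ν ks μ t g φb w φ M ↔
      MixedEqs (valL A) (divL A) (gradL A) ((complianceL E ν).compLpL 2 (volume.restrict A))
        (ks * μ / t ^ 2) (neumannDual φb) (fun δw _ => -g δw) w φ M := by
  have h₁ : ∀ δM : HSymDiv A,
      ∫ x in A, (inner ℝ (δM.val x) (compliance E ν (M.val x)) + inner ℝ (δM.div x) (φ x))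
      = inner ℝ (valL A δM) ((complianceL E ν).compLpL 2 (volume.restrict A) (valL A M))
        + inner ℝ (divL A δM) φ := by
    intro δM
    rw [L2.inner_def, L2.inner_def, ← integral_add (L2.integrable_inner (𝕜 := ℝ) _ _)
      (L2.integrable_inner (𝕜 := ℝ) _ _)]
    refine integral_congr_ae ?_
    filter_upwards [(complianceL E ν).coeFn_compLpL (valL A M)] with x hx
    rw [hx]
    rfl
  have h₂ : ∀ (δw : H01 A) (δφ : L2Vec A),
      ∫ x in A, (inner ℝ (δφ x) (M.div x) -
        (ks * μ / t ^ 2) * inner ℝ (δw.grad x - δφ x) (w.grad x - φ x))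
      = inner ℝ δφ (divL A M) -
        (ks * μ / t ^ 2) * inner ℝ (gradL A δw - δφ) (gradL A w - φ) := by
    intro δw δφ
    rw [L2.inner_def, L2.inner_def, ← integral_const_mul,
      ← integral_sub (L2.integrable_inner (𝕜 := ℝ) _ _)
      ((L2.integrable_inner (𝕜 := ℝ) _ _).const_mul _)]
    refine integral_congr_ae ?_
    filter_upwards [Lp.coeFn_sub (gradL A δw) δφ, Lp.coeFn_sub (gradL A w) φ] with x k₁ k₂
    rw [k₁, k₂]
    rfl
  constructor
  · rintro ⟨e₁, e₂⟩
    exact ⟨fun δM => by rw [← h₁, e₁, neumannDual_apply],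
      fun δw δφ => by rw [← h₂, e₂]⟩
  · rintro ⟨e₁, e₂⟩
    exact ⟨fun δM => by rw [h₁, e₁, neumannDual_apply],
      fun δw δφ => by rw [h₂, e₂]⟩

theorem abs_load_le (g : StrongDual ℝ (H01 A)) (w : H01 A) : |g w| ≤ ‖loadOnY g‖ * ‖w‖ := by
  have h := (loadOnY g).le_opNorm (WithLp.toLp 2 (w, 0))
  have h' := norm_le_norm_fst_add_norm_snd (WithLp.toLp 2 (w, (0 : L2Vec A)))
  rw [WithLp.toLp_fst, WithLp.toLp_snd, norm_zero, add_zero] at h'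
  exact h.trans (by gcongr)

end Concrete

end ReissnerMindlin

theorem mainTheorem2 (A : Set ReissnerMindlin.Plane) (hAopen : IsOpen A)
    (hAbdd : Bornology.IsBounded A) (hAcontr : ContractibleSpace A)
    (E ν κ t : ℝ) (hE : 0 < E) (hν₁ : -1 < ν) (hν₂ : ν < 1) (hκ : 0 < κ) (ht : 0 < t) :
    ∃ c : ℝ, 0 < c ∧ ∀ ks μ : ℝ, 0 < ks → 0 < μ → ks * μ = κ →
      ∀ (g : StrongDual ℝ (ReissnerMindlin.H01 A)) (φb : ReissnerMindlin.H1Vec A),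
        (∃! x : ReissnerMindlin.X A,
          ReissnerMindlin.IsSolution E ν ks μ t g φb x.fst.fst x.fst.snd x.snd) ∧
        ∀ (w : ReissnerMindlin.H01 A) (φ : ReissnerMindlin.L2Vec A)
          (M : ReissnerMindlin.HSymDiv A),
          ReissnerMindlin.IsSolution E ν ks μ t g φb w φ M →
            ‖(WithLp.toLp 2 (w, φ) : ReissnerMindlin.Y A)‖ +
                ‖(WithLp.toLp 2 (M, w.grad - φ) : ReissnerMindlin.Z A)‖
              ≤ c * (‖ReissnerMindlin.loadOnY g‖ + ‖φb‖) := by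
  open ReissnerMindlin in
  obtain ⟨R, hR₀, hR⟩ := hAbdd.exists_pos_norm_le
  have hAm := hAopen.measurableSet
  have hα : 0 < 12 / E * min (1 - ν) (1 + ν) :=
    mul_pos (by positivity) (lt_min (by linarith) (by linarith))
  have hk : 0 < κ / t ^ 2 := by positivity
  obtain ⟨C, hC, hC₁, hC₂⟩ : ∃ C : ℝ, 0 ≤ C ∧ 2 * R + 1 ≤ C ∧
      (∑ i, ‖diagL A i‖) * (2 * R) ≤ C :=
    ⟨max (2 * R + 1) ((∑ i, ‖diagL A i‖) * (2 * R)), by positivity, le_max_left _ _,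
      le_max_right _ _⟩
  have hH : ∀ M, ‖M‖ ≤ ‖valL A M‖ + ‖divL A M‖ := fun M =>
    norm_le_norm_fst_add_norm_snd (M : WithLp 2 (L2Mat A × L2Vec A))
  have hd : ∀ f, ∃ M, divL A M = f ∧ ‖valL A M‖ ≤ C * ‖f‖ := fun f => by
    obtain ⟨M, h₁, h₂⟩ := exists_div_eq hAm hR₀.le hR f
    exact ⟨M, h₁, h₂.trans (by gcongr)⟩
  have hG : ∀ w, ‖w‖ ≤ C * ‖gradL A w‖ := fun w => by
    have h₁ : ‖w‖ ≤ ‖w.val‖ + ‖w.grad‖ :=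
      norm_le_norm_fst_add_norm_snd (w : WithLp 2 (L2 A × L2Vec A))
    have h₂ := H01.norm_val_le hAm hR₀.le hR w
    calc ‖w‖ ≤ (2 * R + 1) * ‖w.grad‖ := by linarith
      _ ≤ C * ‖gradL A w‖ := mul_le_mul_of_nonneg_right hC₁ (norm_nonneg _)
  have ha := compLpL_coercive (μ := volume.restrict A) (complianceL E ν)
    (fun S => compliance_coercive hE S)
  have hs := compLpL_symm (μ := volume.restrict A) (complianceL E ν) fun S T => by
    rw [real_inner_comm, complianceL_apply, complianceL_apply, inner_compliance, inner_compliance,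
      real_inner_comm]
    ring
  obtain ⟨c, hc, hest⟩ := mixed_apriori (valL A) (divL A) (gradL A) _ hk hα hC hH hd hG ha
  -- The factor `2` comes from the bound `2 * ‖φb‖` for the Neumann term.
  refine ⟨2 * c, by positivity, fun ks μ _ _ hksμ g φb => ⟨?_, fun w φ M h => ?_⟩⟩
  · obtain ⟨w, φ, M, hsol⟩ := mixed_exists (valL A) (divL A) (gradL A) _ hk hα hC hH hd hG ha hs
      (neumannDual φb) g
    rw [← hksμ] at hsol
    refine ⟨WithLp.toLp 2 (WithLp.toLp 2 (w, φ), M), isSolution_iff.2 hsol, fun x hx => ?_⟩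
    -- The difference of two solutions has zero data, so the stability estimate kills it.
    have h₀ := (isSolution_iff.1 hx).sub hsol
    rw [hksμ] at h₀
    have h := hest _ _ 0 le_rfl (by simp) (by simp) _ _ _ h₀
    have hM' := hH (x.snd - M)
    rw [mul_zero] at h
    have n₁ := norm_nonneg (x.fst.fst - w)
    have n₂ := norm_nonneg (x.fst.snd - φ)
    have n₃ := norm_nonneg (valL A (x.snd - M))
    have n₄ := norm_nonneg (divL A (x.snd - M))
    have n₅ := norm_nonneg (gradL A (x.fst.fst - w) - (x.fst.snd - φ))
    have hw : x.fst.fst - w = 0 := norm_le_zero_iff.1 (by linarith)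
    have hφ : x.fst.snd - φ = 0 := norm_le_zero_iff.1 (by linarith)
    have hM : x.snd - M = 0 := norm_le_zero_iff.1 (by linarith)
    rw [sub_eq_zero] at hw hφ hM
    rw [← hw, ← hφ, ← hM]
    rfl
  · have h₀ := isSolution_iff.1 h
    rw [hksμ] at h₀
    have h₁ := hest _ _ (‖loadOnY g‖ + 2 * ‖φb‖) (by positivity) (fun δM => ?_)
      (fun δw δφ => ?_) _ _ _ h₀
    · have h₂ := norm_le_norm_fst_add_norm_snd (WithLp.toLp 2 (w, φ))
      have h₃ := norm_le_norm_fst_add_norm_snd (WithLp.toLp 2 (M, w.grad - φ))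
      have h₄ := hH M
      have h₅ : w.grad = gradL A w := rfl
      rw [WithLp.toLp_fst, WithLp.toLp_snd] at h₂ h₃
      rw [h₅] at h₃ ⊢
      have h₆ : 0 ≤ c * ‖loadOnY g‖ := by positivity
      linarith
    · rw [neumannDual_apply]
      refine (abs_neumannTerm_le δM φb).trans ?_
      gcongr
      linarith [norm_nonneg (loadOnY g)]
    · rw [abs_neg]
      refine (abs_load_le g δw).trans ?_
      gcongr
      · linarith [norm_nonneg φb]
      · linarith [norm_nonneg δφ]
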